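/- Let $n\in\mathbb N$ and let $\mathcal G$ be a weighted signed digraph on the nodes $v_1,\dots,v_n$ without self-loops, given by a real matrix $A=[a_{ij}]$ with $a_{ii}=0$, where there is an edge from $v_j$ to $v_i$ if and only if $a_{ij}\neq 0$. Its Laplacian is $L=[l_{ij}]$ with $l_{ii}=\sum_{k}|a_{ik}|$ and $l_{ij}=-a_{ij}$ for $j\ne i$. A node is rooted if every other node can be reached from it by a directed path, and $\mathcal G$ is quasi-strongly connected if it has at least one rooted node. For the system $\dot x(t)=-Lx(t)$, $t\ge 0$, write $\theta=\lim_{t\to\infty}x(t)$ when the limit exists. The system reaches - *interval bipartite consensus* if for every initial state $x(0)\in\mathbb R^n$ the limit $\theta$ exists and there is $\bar\theta\ge 0$ with $\theta_i\in\{-\bar\theta,\bar\theta\}$ for every rooted node $v_i$ and $\theta_i\in[-\bar\theta,\bar\theta]$ for every non-rooted node $v_i$, and moreover $\bar\theta>0$ for at least one initial state; - *bipartite consensus* if for every initial state $\theta$ exists and $|\theta_i|=|\theta_j|$ for all $i,j$, and moreover $\theta\neq 0$ for at least one initial state; - *state stability* if $\theta$ exists and $\theta=0$ for every initial state. Theorem.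 Let $\mathcal G$ be quasi-strongly connected. 1. The system reaches interval bipartite consensus if and only if $\det(L)=0$. If $\det(L)=0$, there is a vector $\xi\in\mathbb R^n$, unique up to sign, with $L\xi=0$ and $\xi_i\in\{-1,1\}$ for every rooted node $v_i$ (the normalized right eigenvector of $L$ for the eigenvalue $0$). The system reaches bipartite consensus if and only if $\det(L)=0$ and $|\xi_1|=|\xi_2|=\cdots=|\xi_n|=1$. 2. The system reaches state stability if and only if $\det(L)\neq 0$. -/

import Mathlib

open Filter Topology

/-- A weighted signed digraph on the nodes `Fin n` without self-loops, given by its real adjacency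
weight matrix `A`: there is a directed edge from node `j` to node `i` iff `A i j ≠ 0`. -/
structure SignedDigraph (n : ℕ) where
  A : Matrix (Fin n) (Fin n) ℝ
  no_loops : ∀ i, A i i = 0

namespace SignedDigraph

variable {n : ℕ}

/-- There is a directed edge from `j` to `i`. -/
def Edge (G : SignedDigraph n) (j i : Fin n) : Prop := G.A i j ≠ 0

/-- The signed Laplacian: `∑ₖ |aᵢₖ|` on the diagonal and `-aᵢⱼ` off the diagonal. -/
def laplacian (G : SignedDigraph n) : Matrix (Fin n) (Fin n) ℝ :=
  Matrix.of fun i j => if i = j then ∑ k, |G.A i k| else -G.A i j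

/-- A rooted node: every other node can be reached from it along directed edges. -/
def IsRooted (G : SignedDigraph n) (i : Fin n) : Prop :=
  ∀ j, j ≠ i → Relation.ReflTransGen G.Edge i j

/-- Quasi-strong connectivity: there is at least one rooted node. -/
def QuasiStronglyConnected (G : SignedDigraph n) : Prop := ∃ i, G.IsRooted i

/-- `x` solves `ẋ = -L x` on `[0, ∞)` (one-sided derivative at `0`). -/
def IsSolution (G : SignedDigraph n) (x : ℝ → Fin n → ℝ) : Prop :=
  ∀ t ∈ Set.Ici (0 : ℝ), HasDerivWithinAt x (-(G.laplacian.mulVec (x t))) (Set.Ici 0) t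

/-- State stability: from every initial state the solution tends to `0`. -/
def ReachesStateStability (G : SignedDigraph n) : Prop :=
  ∀ x, G.IsSolution x → Tendsto x atTop (𝓝 0)

/-- Bipartite consensus: from every initial state the solution has a limit whose entries all have
the same modulus, and this common modulus is positive for at least one initial state. -/
def ReachesBipartiteConsensus (G : SignedDigraph n) : Prop :=
  (∀ x, G.IsSolution x → ∃ θ : Fin n → ℝ, Tendsto x atTop (𝓝 θ) ∧ ∀ i j, |θ i| = |θ j|) ∧
  ∃ x, G.IsSolution x ∧ ∃ θ : Fin n → ℝ, Tendsto x atTop (𝓝 θ) ∧ θ ≠ 0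

/-- The vector `θ` takes the values `±c` at rooted nodes and values in `[-c, c]` at the others. -/
def IsIntervalBipartite (G : SignedDigraph n) (θ : Fin n → ℝ) (c : ℝ) : Prop :=
  0 ≤ c ∧ (∀ i, G.IsRooted i → θ i = -c ∨ θ i = c) ∧
    ∀ i, ¬ G.IsRooted i → θ i ∈ Set.Icc (-c) c

/-- Interval bipartite consensus: from every initial state the solution has a limit that is
`± c` at rooted nodes and in `[-c, c]` at non-rooted nodes, for some `c ≥ 0` (depending on the
initial state), and `c` is positive for at least one initial state. -/
def ReachesIntervalBipartiteConsensus (G : SignedDigraph n) : Prop :=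
  (∀ x, G.IsSolution x → ∃ (θ : Fin n → ℝ) (c : ℝ),
    Tendsto x atTop (𝓝 θ) ∧ G.IsIntervalBipartite θ c) ∧
  ∃ x, G.IsSolution x ∧ ∃ (θ : Fin n → ℝ) (c : ℝ),
    Tendsto x atTop (𝓝 θ) ∧ G.IsIntervalBipartite θ c ∧ 0 < c

/-- `ξ` is a right eigenvector of the Laplacian for the eigenvalue `0`, normalized so that its
entries at the rooted nodes are `1` or `-1`. For a quasi-strongly connected digraph this
normalization forces `ξ ≠ 0`. -/
def IsNormalizedRightEigenvector (G : SignedDigraph n) (ξ : Fin n → ℝ) : Prop :=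
  G.laplacian.mulVec ξ = 0 ∧ ∀ i, G.IsRooted i → ξ i = 1 ∨ ξ i = -1

end SignedDigraph

/-- The second central moment of the (unnormalized) Poisson weights. -/
theorem hasSum_sq_sub_mul_pow_div_factorial (s : ℝ) :
    HasSum (fun k : ℕ => ((k : ℝ) - s) ^ 2 * (s ^ k / k.factorial)) (s * Real.exp s) := by
  have h0 : HasSum (fun k : ℕ => s ^ k / k.factorial) (Real.exp s) := by
    rw [Real.exp_eq_exp_ℝ]; exact NormedSpace.expSeries_div_hasSum_exp s
  have h1 : HasSum (fun k : ℕ => (k : ℝ) * (s ^ k / k.factorial)) (s * Real.exp s) := by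
    have := (hasSum_nat_add_iff (f := fun k : ℕ => (k : ℝ) * (s ^ k / k.factorial))
      (g := s * Real.exp s) 1).1 ?_
    · simpa using this
    · refine (h0.mul_left s).congr_fun ?_
      intro k
      have : ((k.factorial : ℕ) : ℝ) ≠ 0 := by positivity
      have : (k : ℝ) + 1 ≠ 0 := by positivity
      simp only [Nat.factorial_succ]; push_cast; field_simp; ring
  have h2 : HasSum (fun k : ℕ => (k : ℝ) * ((k : ℝ) - 1) * (s ^ k / k.factorial))
      (s * (s * Real.exp s)) := by
    have := (hasSum_nat_add_iff (f := fun k : ℕ => (k : ℝ) * ((k : ℝ) - 1) * (s ^ k / k.factorial))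
      (g := s * (s * Real.exp s)) 1).1 ?_
    · simpa using this
    · refine (h1.mul_left s).congr_fun ?_
      intro k
      have : ((k.factorial : ℕ) : ℝ) ≠ 0 := by positivity
      have : (k : ℝ) + 1 ≠ 0 := by positivity
      simp only [Nat.factorial_succ]; push_cast; field_simp; ring
  convert (h2.add (h1.mul_left (1 - 2 * s))).add (h0.mul_left (s ^ 2)) using 1
  · ext k; ring
  · ring

/-- For a power contraction `M`, `exp (s M) (M - 1)` is of order `exp s / √s`. -/
theorem norm_exp_smul_mul_sub_one_le {𝔸 : Type*} [NormedRing 𝔸] [NormedAlgebra ℝ 𝔸]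
    [CompleteSpace 𝔸] {M : 𝔸} (hM : ∀ k : ℕ, ‖M ^ k‖ ≤ 1) {s : ℝ} (hs : 0 < s) :
    ‖NormedSpace.exp (s • M) * (M - 1)‖ ≤ Real.exp s / √s := by
  have hexp : HasSum (fun k : ℕ => (s ^ k / k.factorial) • M ^ k) (NormedSpace.exp (s • M)) := by
    convert NormedSpace.exp_series_hasSum_exp' (𝕂 := ℝ) (s • M) using 2 with k
    rw [smul_pow, smul_smul]; congr 1; ring
  have hshift : HasSum (fun k : ℕ => ((k : ℝ) * (s ^ k / k.factorial)) • M ^ k)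
      (s • (NormedSpace.exp (s • M) * M)) := by
    have := (hasSum_nat_add_iff (f := fun k : ℕ => ((k : ℝ) * (s ^ k / k.factorial)) • M ^ k)
      (g := s • (NormedSpace.exp (s • M) * M)) 1).1 ?_
    · simpa using this
    · refine ((hexp.mul_right M).const_smul s).congr_fun ?_
      intro k
      have : ((k.factorial : ℕ) : ℝ) ≠ 0 := by positivity
      have : (k : ℝ) + 1 ≠ 0 := by positivity
      rw [smul_mul_assoc, smul_smul, ← pow_succ]
      congr 1
      simp only [Nat.factorial_succ]; push_cast; field_simp; ring
  have hsum : HasSum (fun k : ℕ => (((k : ℝ) - s) * (s ^ k / k.factorial)) • M ^ k)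
      (s • (NormedSpace.exp (s • M) * (M - 1))) := by
    rw [mul_sub, smul_sub, mul_one]
    refine (hshift.sub (hexp.const_smul s)).congr_fun fun k => ?_
    rw [smul_smul, ← sub_smul]; congr 1; ring
  have hr : 0 < √s := Real.sqrt_pos.2 hs
  have hr2 : √s * √s = s := Real.mul_self_sqrt hs.le
  have h0 : HasSum (fun k : ℕ => s ^ k / k.factorial) (Real.exp s) := by
    rw [Real.exp_eq_exp_ℝ]; exact NormedSpace.expSeries_div_hasSum_exp s
  have hbound : HasSum (fun k : ℕ => √s / 2 * (s ^ k / k.factorial)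
      + 1 / (2 * √s) * (((k : ℝ) - s) ^ 2 * (s ^ k / k.factorial))) (√s * Real.exp s) := by
    have h := (h0.mul_left (√s / 2)).add
      ((hasSum_sq_sub_mul_pow_div_factorial s).mul_left (1 / (2 * √s)))
    have he : √s / 2 * Real.exp s + 1 / (2 * √s) * (s * Real.exp s) = √s * Real.exp s := by
      have hs' : s / √s = √s := Real.div_sqrt
      calc _ = (√s + s / √s) / 2 * Real.exp s := by field_simp
        _ = _ := by rw [hs']; ring
    rwa [he] at h
  have hle : ‖s • (NormedSpace.exp (s • M) * (M - 1))‖ ≤ √s * Real.exp s := by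
    rw [← hsum.tsum_eq]
    refine tsum_of_norm_bounded hbound fun k => ?_
    have hp : 0 ≤ s ^ k / (k.factorial : ℝ) := by positivity
    have habs : |(k : ℝ) - s| ≤ √s / 2 + 1 / (2 * √s) * ((k : ℝ) - s) ^ 2 := by
      have : √s / 2 + 1 / (2 * √s) * ((k : ℝ) - s) ^ 2 - |(k : ℝ) - s|
          = (√s - |(k : ℝ) - s|) ^ 2 / (2 * √s) := by
        rw [← sq_abs ((k : ℝ) - s)]; field_simp; ring
      have : 0 ≤ (√s - |(k : ℝ) - s|) ^ 2 / (2 * √s) := by positivity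
      linarith
    calc ‖(((k : ℝ) - s) * (s ^ k / k.factorial)) • M ^ k‖
        = |(k : ℝ) - s| * (s ^ k / k.factorial) * ‖M ^ k‖ := by
          rw [norm_smul, Real.norm_eq_abs, abs_mul, abs_of_nonneg hp]
      _ ≤ |(k : ℝ) - s| * (s ^ k / k.factorial) * 1 := by gcongr; exact hM k
      _ ≤ (√s / 2 + 1 / (2 * √s) * ((k : ℝ) - s) ^ 2) * (s ^ k / k.factorial) := by
          rw [mul_one]; gcongr
      _ = _ := by ring
  rw [norm_smul, Real.norm_of_nonneg hs.le] at hle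
  rw [le_div_iff₀ hr]
  refine le_of_mul_le_mul_left ?_ hr
  calc _ = √s * √s * ‖NormedSpace.exp (s • M) * (M - 1)‖ := by ring
    _ ≤ _ := by rw [hr2]; exact hle

section LinearFlow

variable {E : Type*} [NormedAddCommGroup E] [NormedSpace ℝ E]

/-- Forward uniqueness for an autonomous linear equation. -/
theorem eqOn_Ici_of_hasDerivWithinAt_clm (T : E →L[ℝ] E) {x y : ℝ → E}
    (hx : ∀ t ∈ Set.Ici (0 : ℝ), HasDerivWithinAt x (T (x t)) (Set.Ici 0) t)
    (hy : ∀ t ∈ Set.Ici (0 : ℝ), HasDerivWithinAt y (T (y t)) (Set.Ici 0) t)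
    (h0 : x 0 = y 0) : Set.EqOn x y (Set.Ici 0) := by
  intro t ht
  have hc : ∀ {z : ℝ → E}, (∀ t ∈ Set.Ici (0 : ℝ), HasDerivWithinAt z (T (z t)) (Set.Ici 0) t) →
      ContinuousOn z (Set.Icc 0 t) := fun hz u hu =>
    (hz u hu.1).continuousWithinAt.mono Set.Icc_subset_Ici_self
  exact ODE_solution_unique (v := fun _ => T) (fun _ => T.lipschitz) (hc hx)
    (fun u hu => (hx u hu.1).mono (Set.Ici_subset_Ici.2 hu.1)) (hc hy)
    (fun u hu => (hy u hu.1).mono (Set.Ici_subset_Ici.2 hu.1)) h0 ⟨ht, le_rfl⟩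

variable [CompleteSpace E]

theorem hasDerivAt_exp_neg_smul_exp_smul (M : E →L[ℝ] E) (c : ℝ) (v : E) (t : ℝ) :
    HasDerivAt (fun t : ℝ => Real.exp (-(c * t)) • NormedSpace.exp ((c * t) • M) v)
      (c • (M - 1) (Real.exp (-(c * t)) • NormedSpace.exp ((c * t) • M) v)) t := by
  have hct : HasDerivAt (fun t : ℝ => c * t) c t := by simpa using (hasDerivAt_id t).const_mul c
  have h1 := (hasDerivAt_exp_smul_const' (𝕂 := ℝ) M (c * t)).scomp t hct
  have h2 : HasDerivAt (fun t : ℝ => NormedSpace.exp ((c * t) • M) v)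
      ((c • (M * NormedSpace.exp ((c * t) • M))) v) t :=
    (ContinuousLinearMap.apply ℝ E v).hasFDerivAt.comp_hasDerivAt t h1
  have h3 : HasDerivAt (fun t : ℝ => Real.exp (-(c * t))) (Real.exp (-(c * t)) * -c) t :=
    hct.neg.exp
  refine (h3.smul h2).congr_deriv ?_
  simp only [sub_apply, smul_apply, mul_apply_eq_comp, one_apply_eq_self, map_smul]
  module

theorem tendsto_exp_neg_smul_exp_smul_sub_one {M : E →L[ℝ] E} (hM : ‖M‖ ≤ 1) {c : ℝ} (hc : 0 < c)
    (w : E) :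
    Tendsto (fun t : ℝ => Real.exp (-(c * t)) • NormedSpace.exp ((c * t) • M) ((M - 1) w))
      atTop (𝓝 0) := by
  have hpow : ∀ k : ℕ, ‖M ^ k‖ ≤ 1 := by
    intro k
    rcases Nat.eq_zero_or_pos k with rfl | hk
    · rw [pow_zero]; exact ContinuousLinearMap.norm_id_le
    · exact (norm_pow_le' M hk).trans (pow_le_one₀ (norm_nonneg _) hM)
  have hlim : Tendsto (fun t : ℝ => (√(c * t))⁻¹ * ‖w‖) atTop (𝓝 0) := by
    have : Tendsto (fun t : ℝ => √(c * t)) atTop atTop :=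
      Real.tendsto_sqrt_atTop.comp (tendsto_id.const_mul_atTop hc)
    simpa using this.inv_tendsto_atTop.mul_const ‖w‖
  refine squeeze_zero_norm' ?_ hlim
  filter_upwards [eventually_gt_atTop 0] with t ht
  have hct : 0 < c * t := mul_pos hc ht
  rw [norm_smul, Real.norm_of_nonneg (Real.exp_pos _).le]
  calc Real.exp (-(c * t)) * ‖NormedSpace.exp ((c * t) • M) ((M - 1) w)‖
      ≤ Real.exp (-(c * t)) * (Real.exp (c * t) / √(c * t) * ‖w‖) := by
        gcongr
        exact (NormedSpace.exp ((c * t) • M) * (M - 1)).le_of_opNorm_le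
          (norm_exp_smul_mul_sub_one_le hpow hct) w
    _ = (√(c * t))⁻¹ * ‖w‖ := by
        rw [Real.exp_neg]; field_simp

/-- Mean ergodic theorem for the semigroup generated by `c (M - 1)`, `M` a contraction of a
finite-dimensional space: every trajectory converges to an equilibrium. -/
theorem exists_tendsto_of_hasDerivWithinAt_contraction [FiniteDimensional ℝ E]
    {M : E →L[ℝ] E} (hM : ‖M‖ ≤ 1) {c : ℝ} (hc : 0 < c) {x : ℝ → E}
    (hx : ∀ t ∈ Set.Ici (0 : ℝ), HasDerivWithinAt x ((c • (M - 1)) (x t)) (Set.Ici 0) t) :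
    ∃ θ, Tendsto x atTop (𝓝 θ) ∧ M θ = θ := by
  have hsol : ∀ θ w : E, M θ = θ → ∀ y : ℝ → E,
      (∀ t ∈ Set.Ici (0 : ℝ), HasDerivWithinAt y ((c • (M - 1)) (y t)) (Set.Ici 0) t) →
      y 0 = θ + (M - 1) w → Tendsto y atTop (𝓝 θ) := by
    intro θ w hθ y hy hy0
    have heq := eqOn_Ici_of_hasDerivWithinAt_clm (c • (M - 1)) hy (y := fun t : ℝ =>
      θ + Real.exp (-(c * t)) • NormedSpace.exp ((c * t) • M) ((M - 1) w)) (fun t _ => by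
        have := (hasDerivAt_exp_neg_smul_exp_smul M c ((M - 1) w) t).const_add θ
        convert this.hasDerivWithinAt using 1
        rw [smul_apply, map_add]
        simp [hθ]) (by simp [hy0])
    have hlim := (tendsto_exp_neg_smul_exp_smul_sub_one hM hc w).const_add θ
    rw [add_zero] at hlim
    refine hlim.congr' ?_
    filter_upwards [eventually_ge_atTop 0] with t ht
    exact (heq ht).symm
  set K : E →ₗ[ℝ] E := ((M - 1 : E →L[ℝ] E) : E →ₗ[ℝ] E) with hK
  have hmem : ∀ v, v ∈ LinearMap.ker K ↔ M v = v := by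
    intro v; simp [hK, sub_eq_zero]
  have hdisj : Disjoint (LinearMap.ker K) (LinearMap.range K) := by
    rw [Submodule.disjoint_def]
    rintro v hv ⟨w, rfl⟩
    have hv' := (hmem _).1 hv
    have := hsol 0 w (map_zero M) (fun _ => K w) (fun t _ => by
      convert hasDerivWithinAt_const t (Set.Ici (0 : ℝ)) (K w) using 1
      simp [hv']) (by simp [hK])
    exact tendsto_nhds_unique tendsto_const_nhds this
  have htop := Submodule.eq_top_of_disjoint _ _
    (by rw [add_comm, LinearMap.finrank_range_add_finrank_ker]) hdisj
  obtain ⟨θ, hθ, y, ⟨w, rfl⟩, hxy⟩ := Submodule.mem_sup.1 (htop ▸ Submodule.mem_top : x 0 ∈ _)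
  exact ⟨θ, hsol θ w ((hmem θ).1 hθ) x hx hxy.symm, (hmem θ).1 hθ⟩

end LinearFlow

namespace SignedDigraph

variable {n : ℕ} (G : SignedDigraph n)

theorem laplacian_mulVec (x : Fin n → ℝ) (i : Fin n) :
    G.laplacian.mulVec x i = ∑ k, (|G.A i k| * x i - G.A i k * x k) := by
  have h : ∀ k, G.laplacian i k * x k
      = (if i = k then (∑ k, |G.A i k|) * x i else 0) - G.A i k * x k := by
    intro k
    by_cases hik : i = k
    · subst hik; simp [laplacian, G.no_loops]
    · simp [laplacian, hik]
  simp [Matrix.mulVec, dotProduct, h, Finset.sum_sub_distrib, Finset.sum_mul]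

theorem abs_eq_norm_of_edge {x : Fin n → ℝ} (hx : G.laplacian.mulVec x = 0) {i j : Fin n}
    (hi : |x i| = ‖x‖) (hji : G.Edge j i) : |x j| = ‖x‖ := by
  have hle : ∀ k, |x k| ≤ ‖x‖ := fun k => norm_le_pi_norm x k
  have hsum : ∑ k, |G.A i k| * (‖x‖ - |x k|) ≤ 0 := by
    have h0 := congrFun hx i
    rw [laplacian_mulVec, Finset.sum_sub_distrib, Pi.zero_apply, sub_eq_zero, ← Finset.sum_mul]
      at h0
    have h1 : (∑ k, |G.A i k|) * ‖x‖ ≤ ∑ k, |G.A i k| * |x k| := by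
      calc (∑ k, |G.A i k|) * ‖x‖ = |(∑ k, |G.A i k|) * x i| := by
            rw [abs_mul, hi, abs_of_nonneg (Finset.sum_nonneg fun k _ => abs_nonneg _)]
        _ = |∑ k, G.A i k * x k| := by rw [h0]
        _ ≤ ∑ k, |G.A i k * x k| := Finset.abs_sum_le_sum_abs _ _
        _ = _ := by simp only [abs_mul]
    simp only [mul_sub, Finset.sum_sub_distrib, ← Finset.sum_mul]
    linarith
  have hnn : ∀ k ∈ Finset.univ, 0 ≤ |G.A i k| * (‖x‖ - |x k|) := fun k _ =>
    mul_nonneg (abs_nonneg _) (sub_nonneg.2 (hle k))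
  have := (Finset.sum_eq_zero_iff_of_nonneg hnn).1
    (le_antisymm hsum (Finset.sum_nonneg hnn)) j (Finset.mem_univ j)
  rcases mul_eq_zero.1 this with h | h
  · exact absurd (abs_eq_zero.1 h) hji
  · linarith

/-- A vector in the kernel of the Laplacian attains its maximal modulus at every rooted node. -/
theorem abs_eq_norm_of_isRooted {x : Fin n → ℝ} (hx : G.laplacian.mulVec x = 0) {r : Fin n}
    (hr : G.IsRooted r) : |x r| = ‖x‖ := by
  have : Nonempty (Fin n) := ⟨r⟩
  obtain ⟨m, -, hm⟩ := Finset.exists_max_image Finset.univ (fun i => |x i|) Finset.univ_nonempty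
  have hmx : |x m| = ‖x‖ := le_antisymm (norm_le_pi_norm x m)
    ((pi_norm_le_iff_of_nonneg (abs_nonneg _)).2 fun i => hm i (Finset.mem_univ i))
  by_cases hmr : m = r
  · exact hmr ▸ hmx
  · exact Relation.ReflTransGen.head_induction_on (motive := fun a _ => |x a| = ‖x‖) (hr m hmr) hmx
      fun h _ ih => G.abs_eq_norm_of_edge hx ih h

/-- `1 - h L` is a contraction for the supremum norm once `h` is small. -/
theorem norm_sub_smul_laplacian_mulVec_le {h : ℝ} (h0 : 0 ≤ h)
    (hh : ∀ i, h * ∑ k, |G.A i k| ≤ 1) (x : Fin n → ℝ) :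
    ‖x - h • G.laplacian.mulVec x‖ ≤ ‖x‖ := by
  refine (pi_norm_le_iff_of_nonneg (norm_nonneg _)).2 fun i => ?_
  have hle : ∀ k, |x k| ≤ ‖x‖ := fun k => norm_le_pi_norm x k
  have hrw : (x - h • G.laplacian.mulVec x) i
      = (1 - h * ∑ k, |G.A i k|) * x i + h * ∑ k, G.A i k * x k := by
    simp only [Pi.sub_apply, Pi.smul_apply, smul_eq_mul, laplacian_mulVec, Finset.sum_sub_distrib,
      ← Finset.sum_mul]
    ring
  rw [hrw, Real.norm_eq_abs]
  have hd : 0 ≤ 1 - h * ∑ k, |G.A i k| := sub_nonneg.2 (hh i)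
  calc _ ≤ |(1 - h * ∑ k, |G.A i k|) * x i| + |h * ∑ k, G.A i k * x k| := abs_add_le _ _
    _ ≤ (1 - h * ∑ k, |G.A i k|) * ‖x‖ + h * ∑ k, |G.A i k| * ‖x‖ := by
      rw [abs_mul, abs_mul, abs_of_nonneg hd, abs_of_nonneg h0]
      gcongr
      · exact hle i
      · refine (Finset.abs_sum_le_sum_abs _ _).trans (Finset.sum_le_sum fun k _ => ?_)
        rw [abs_mul]
        gcongr
        exact hle k
    _ = ‖x‖ := by rw [← Finset.sum_mul]; ring

theorem IsSolution.exists_tendsto {G : SignedDigraph n} {x : ℝ → Fin n → ℝ} (hx : G.IsSolution x) :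
    ∃ θ, Tendsto x atTop (𝓝 θ) ∧ G.laplacian.mulVec θ = 0 := by
  set c : ℝ := 1 + ∑ i, ∑ k, |G.A i k| with hc
  have hnn : ∀ i, 0 ≤ ∑ k, |G.A i k| := fun i => Finset.sum_nonneg fun k _ => abs_nonneg _
  have hcpos : 0 < c := by
    have := Finset.sum_nonneg fun i (_ : i ∈ Finset.univ) => hnn i
    linarith
  have hci : ∀ i, c⁻¹ * ∑ k, |G.A i k| ≤ 1 := by
    intro i
    rw [inv_mul_le_iff₀ hcpos, mul_one]
    have := Finset.single_le_sum (fun i _ => hnn i) (Finset.mem_univ i)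
    linarith
  set T : (Fin n → ℝ) →L[ℝ] (Fin n → ℝ) :=
    LinearMap.toContinuousLinearMap G.laplacian.mulVecLin with hT
  have hTx : ∀ v, T v = G.laplacian.mulVec v := fun v => rfl
  have hM : ‖(1 : (Fin n → ℝ) →L[ℝ] (Fin n → ℝ)) - c⁻¹ • T‖ ≤ 1 :=
    ContinuousLinearMap.opNorm_le_bound _ zero_le_one fun v => by
      rw [one_mul]
      exact G.norm_sub_smul_laplacian_mulVec_le (inv_nonneg.2 hcpos.le) hci v
  obtain ⟨θ, hlim, hθ⟩ := exists_tendsto_of_hasDerivWithinAt_contraction hM hcpos (x := x)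
    (fun t ht => by
      refine (hx t ht).congr_deriv ?_
      simp [hTx, smul_smul, hcpos.ne'])
  refine ⟨θ, hlim, ?_⟩
  simpa [hTx, hcpos.ne'] using hθ

theorem isSolution_const {v : Fin n → ℝ} (hv : G.laplacian.mulVec v = 0) :
    G.IsSolution fun _ => v := by
  intro t _
  simpa [hv] using hasDerivWithinAt_const t (Set.Ici (0 : ℝ)) v

theorem IsSolution.laplacian_mulVec_eq_zero {G : SignedDigraph n} {x : ℝ → Fin n → ℝ}
    (hx : G.IsSolution x) {θ : Fin n → ℝ} (hθ : Tendsto x atTop (𝓝 θ)) :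
    G.laplacian.mulVec θ = 0 := by
  obtain ⟨θ', h, h0⟩ := hx.exists_tendsto
  rwa [tendsto_nhds_unique hθ h]

theorem isNormalizedRightEigenvector_inv_norm_smul {v : Fin n → ℝ}
    (hv : G.laplacian.mulVec v = 0) (hv0 : v ≠ 0) :
    G.IsNormalizedRightEigenvector (‖v‖⁻¹ • v) := by
  refine ⟨by rw [Matrix.mulVec_smul, hv, smul_zero], fun i hi => ?_⟩
  have hn : ‖v‖ ≠ 0 := norm_ne_zero_iff.2 hv0
  rw [← abs_eq zero_le_one, Pi.smul_apply, smul_eq_mul, abs_mul, G.abs_eq_norm_of_isRooted hv hi,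
    abs_inv, abs_norm, inv_mul_cancel₀ hn]

theorem exists_isNormalizedRightEigenvector (h : G.laplacian.det = 0) :
    ∃ ξ, G.IsNormalizedRightEigenvector ξ := by
  obtain ⟨v, hv0, hv⟩ := Matrix.exists_mulVec_eq_zero_iff.2 h
  exact ⟨_, G.isNormalizedRightEigenvector_inv_norm_smul hv hv0⟩

theorem eq_of_mulVec_eq_zero_of_isRooted {v w : Fin n → ℝ} (hv : G.laplacian.mulVec v = 0)
    (hw : G.laplacian.mulVec w = 0) {r : Fin n} (hr : G.IsRooted r) (h : v r = w r) : v = w := by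
  have h0 : G.laplacian.mulVec (v - w) = 0 := by rw [Matrix.mulVec_sub, hv, hw, sub_zero]
  have := G.abs_eq_norm_of_isRooted h0 hr
  rw [Pi.sub_apply, h, sub_self, abs_zero] at this
  exact sub_eq_zero.1 (norm_eq_zero.1 this.symm)

theorem IsNormalizedRightEigenvector.eq_or_eq_neg {G : SignedDigraph n}
    (hG : G.QuasiStronglyConnected) {ξ ξ' : Fin n → ℝ} (hξ : G.IsNormalizedRightEigenvector ξ)
    (hξ' : G.IsNormalizedRightEigenvector ξ') : ξ' = ξ ∨ ξ' = -ξ := by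
  obtain ⟨r, hr⟩ := hG
  have hneg : G.laplacian.mulVec (-ξ) = 0 := by rw [Matrix.mulVec_neg, hξ.1, neg_zero]
  have habs : ξ' r = ξ r ∨ ξ' r = -ξ r := by
    rcases hξ.2 r hr with h | h <;> rcases hξ'.2 r hr with h' | h' <;> simp [h, h']
  exact habs.imp (G.eq_of_mulVec_eq_zero_of_isRooted hξ'.1 hξ.1 hr)
    (G.eq_of_mulVec_eq_zero_of_isRooted hξ'.1 hneg hr)

theorem isIntervalBipartite_norm {θ : Fin n → ℝ} (hθ : G.laplacian.mulVec θ = 0) :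
    G.IsIntervalBipartite θ ‖θ‖ :=
  ⟨norm_nonneg _, fun _ hi => ((abs_eq (norm_nonneg _)).1 (G.abs_eq_norm_of_isRooted hθ hi)).symm,
    fun i _ => abs_le.1 (norm_le_pi_norm θ i)⟩

end SignedDigraph

theorem theorem4 {n : ℕ} (G : SignedDigraph n) (hG : G.QuasiStronglyConnected) :
    (G.ReachesIntervalBipartiteConsensus ↔ G.laplacian.det = 0) ∧
    (G.laplacian.det = 0 →
      ∃ ξ, G.IsNormalizedRightEigenvector ξ ∧
        ∀ ξ', G.IsNormalizedRightEigenvector ξ' → ξ' = ξ ∨ ξ' = -ξ) ∧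
    (G.ReachesBipartiteConsensus ↔
      G.laplacian.det = 0 ∧ ∀ ξ, G.IsNormalizedRightEigenvector ξ → ∀ i, |ξ i| = 1) ∧
    (G.ReachesStateStability ↔ G.laplacian.det ≠ 0) := by
  obtain ⟨r, hr⟩ := id hG
  have hdet : ∀ {θ : Fin n → ℝ}, G.laplacian.mulVec θ = 0 → θ ≠ 0 → G.laplacian.det = 0 :=
    fun h h0 => Matrix.exists_mulVec_eq_zero_iff.1 ⟨_, h0, h⟩
  have hne : ∀ {ξ}, G.IsNormalizedRightEigenvector ξ → ξ ≠ 0 := by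
    rintro ξ hξ rfl
    have := hξ.2 r hr
    norm_num at this
  refine ⟨⟨?_, ?_⟩, ?_, ⟨?_, ?_⟩, ⟨?_, ?_⟩⟩
  · rintro ⟨-, x, hx, θ, c, hlim, hθ, hc⟩
    refine hdet (hx.laplacian_mulVec_eq_zero hlim) ?_
    rintro rfl
    rcases hθ.2.1 r hr with h | h <;> rw [Pi.zero_apply] at h <;> linarith
  · intro h
    obtain ⟨ξ, hξ⟩ := G.exists_isNormalizedRightEigenvector h
    refine ⟨fun x hx => ?_, _, G.isSolution_const hξ.1, ξ, ‖ξ‖, tendsto_const_nhds,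
      G.isIntervalBipartite_norm hξ.1, norm_pos_iff.2 (hne hξ)⟩
    obtain ⟨θ, hlim, hθ⟩ := hx.exists_tendsto
    exact ⟨θ, ‖θ‖, hlim, G.isIntervalBipartite_norm hθ⟩
  · intro h
    obtain ⟨ξ, hξ⟩ := G.exists_isNormalizedRightEigenvector h
    exact ⟨ξ, hξ, fun ξ' hξ' => hξ.eq_or_eq_neg hG hξ'⟩
  · rintro ⟨hall, x, hx, θ, hlim, hθ⟩
    refine ⟨hdet (hx.laplacian_mulVec_eq_zero hlim) hθ, fun ξ hξ i => ?_⟩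
    obtain ⟨θ', hlim', heq⟩ := hall _ (G.isSolution_const hξ.1)
    obtain rfl := tendsto_nhds_unique tendsto_const_nhds hlim'
    rw [heq i r]
    exact (abs_eq zero_le_one).2 (hξ.2 r hr)
  · rintro ⟨h, hone⟩
    obtain ⟨ξ, hξ⟩ := G.exists_isNormalizedRightEigenvector h
    refine ⟨fun x hx => ?_, _, G.isSolution_const hξ.1, ξ, tendsto_const_nhds, hne hξ⟩
    obtain ⟨θ, hlim, hθ⟩ := hx.exists_tendsto
    refine ⟨θ, hlim, ?_⟩
    by_cases h0 : θ = 0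
    · simp [h0]
    have hn : ‖θ‖ ≠ 0 := norm_ne_zero_iff.2 h0
    have habs : ∀ i, |θ i| = ‖θ‖ := by
      intro i
      have := hone _ (G.isNormalizedRightEigenvector_inv_norm_smul hθ h0) i
      rwa [Pi.smul_apply, smul_eq_mul, abs_mul, abs_inv, abs_norm, inv_mul_eq_one₀ hn,
        eq_comm] at this
    exact fun i j => (habs i).trans (habs j).symm
  · intro hstab h
    obtain ⟨ξ, hξ⟩ := G.exists_isNormalizedRightEigenvector h
    exact hne hξ (tendsto_nhds_unique tendsto_const_nhds (hstab _ (G.isSolution_const hξ.1)))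
  · intro h x hx
    obtain ⟨θ, hlim, hθ⟩ := hx.exists_tendsto
    by_cases h0 : θ = 0
    · exact h0 ▸ hlim
    · exact absurd (hdet hθ h0) h
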